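/- Let $d\ge 1$ and let $K\colon\mathbb{R}^d\to[0,+\infty)$ be a Lebesgue measurable even function such that $h\mapsto K(h)\min\{1,|h|\}$ belongs to $L^1(\mathbb{R}^d)$. For Lebesgue measurable sets $E,F\subset\mathbb{R}^d$ put $L_K(E,F)=\int_F\int_E K(y-x)\,dy\,dx$ and, for measurable $E,\Omega$, $$\mathrm{Per}_K(E,\Omega)=L_K(E\cap\Omega,E^c\cap\Omega)+L_K(E\cap\Omega,E^c\cap\Omega^c)+L_K(E\cap\Omega^c,E^c\cap\Omega).$$ Let $\Omega\subset\mathbb{R}^d$ be an open set with $0<|\Omega|<+\infty$. A measurable set $E$ is a Caccioppoli set in $\mathbb{R}^d$ if $|E|<+\infty$ and its De Giorgi perimeter $\mathrm{Per}(E)=|D\chi_E|(\mathbb{R}^d)=\sup\{\int_E \mathrm{div}\,\varphi\,dx : \varphi\in C^1_c(\mathbb{R}^d;\mathbb{R}^d),\ |\varphi|\le 1\}$ is finite. (a) For every Caccioppoli set $E$ in $\mathbb{R}^d$, $$\mathrm{Per}_K(E,\Omega)\le \max\Big\{\frac{\mathrm{Per}(E)}{2},|\Omega|\Big\}\int_{\mathbb{R}^d}K(h)\min\{1,|h|\}\,dh,$$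 and in particular $\mathrm{Per}_K(E,\Omega)<+\infty$. (b) $p_\Omega:=\mathrm{Per}_K(\cdot,\Omega)$ is a perimeter in $\Omega$ in the following sense, for all Lebesgue measurable $E,F\subset\mathbb{R}^d$: 1. $p_\Omega(\emptyset)=0$; 2. $p_\Omega(E)=p_\Omega(F)$ whenever $|E\bigtriangleup F|=0$; 3. $p_{\Omega+h}(E+h)=p_\Omega(E)$ for every $h\in\mathbb{R}^d$; 4. $p_\Omega(\overline{A})<+\infty$ for every open set $A\subset\mathbb{R}^d$ whose boundary is compact and of class $C^2$ (near each of its points, $\partial A$ is the zero set of a $C^2$ function whose differential does not vanish at that point); 5. $p_\Omega(E)\le\liminf_{n\to\infty}p_\Omega(E_n)$ whenever the $E_n$ are measurable and $|(E_n\bigtriangleup E)\cap C|\to0$ for every compact $C\subset\mathbb{R}^d$; 6. $p_\Omega(E\cap F)+p_\Omega(E\cup F)\le p_\Omega(E)+p_\Omega(F)$. -/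

import Mathlib

open MeasureTheory Filter Topology
open scoped ENNReal NNReal

noncomputable section

/-- The divergence `∑ i, ∂ᵢ φᵢ` of a vector field on `ℝ^d`. -/
def divergence {d : ℕ} (φ : EuclideanSpace ℝ (Fin d) → EuclideanSpace ℝ (Fin d))
    (x : EuclideanSpace ℝ (Fin d)) : ℝ :=
  ∑ i : Fin d, (fderiv ℝ φ x (EuclideanSpace.single i (1 : ℝ))) i

/-- De Giorgi's perimeter `Per(E) = |Dχ_E|(ℝ^d)`: the total variation of the distributional
gradient of the characteristic function of `E`, that is, the supremum of `∫_E div φ` over the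
`C¹` compactly supported vector fields `φ` with `|φ| ≤ 1`. -/
def perimeter {d : ℕ} (E : Set (EuclideanSpace ℝ (Fin d))) : ℝ≥0∞ :=
  ⨆ (φ : EuclideanSpace ℝ (Fin d) → EuclideanSpace ℝ (Fin d))
    (_ : ContDiff ℝ 1 φ ∧ HasCompactSupport φ ∧ ∀ x, ‖φ x‖ ≤ 1),
    ENNReal.ofReal (∫ x in E, divergence φ x)

/-- `E` is a Caccioppoli set in `ℝ^d`: it is Lebesgue measurable and `χ_E` is a function of
bounded variation, i.e. `χ_E ∈ L¹(ℝ^d)` and `|Dχ_E|(ℝ^d) < ∞`. -/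
def IsCaccioppoli {d : ℕ} (E : Set (EuclideanSpace ℝ (Fin d))) : Prop :=
  NullMeasurableSet E volume ∧ volume E < ∞ ∧ perimeter E < ∞

/-- The nonlocal interaction `L_K(E, F) = ∫_F ∫_E K(y - x) dy dx`. -/
def interaction {d : ℕ} (K : EuclideanSpace ℝ (Fin d) → ℝ≥0∞)
    (E F : Set (EuclideanSpace ℝ (Fin d))) : ℝ≥0∞ :=
  ∫⁻ x in F, ∫⁻ y in E, K (y - x)

/-- The nonlocal perimeter `Per_K(E, Ω)`. -/
def nonlocalPerimeter {d : ℕ} (K : EuclideanSpace ℝ (Fin d) → ℝ≥0∞)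
    (E Ω : Set (EuclideanSpace ℝ (Fin d))) : ℝ≥0∞ :=
  interaction K (E ∩ Ω) (Eᶜ ∩ Ω) + interaction K (E ∩ Ω) (Eᶜ ∩ Ωᶜ)
    + interaction K (E ∩ Ωᶜ) (Eᶜ ∩ Ω)

/-- The boundary of `A` is a `C²` hypersurface: around each of its points it is the zero set of
a `C²` function whose differential does not vanish at that point. (`A` is not required to lie
locally on one side of its boundary; every set of class `C²` in the one-sided sense is
covered.) -/
def HasC2Boundary {d : ℕ} (A : Set (EuclideanSpace ℝ (Fin d))) : Prop :=
  ∀ x ∈ frontier A, ∃ (U : Set (EuclideanSpace ℝ (Fin d))) (ψ : EuclideanSpace ℝ (Fin d) → ℝ),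
    IsOpen U ∧ x ∈ U ∧ ContDiffOn ℝ 2 ψ U ∧ fderiv ℝ ψ x ≠ 0 ∧
      frontier A ∩ U = {y | ψ y = 0} ∩ U

/-- `E n → E` in `L¹_loc(ℝ^d)`. -/
def ConvergesL1Loc {d : ℕ} (E : ℕ → Set (EuclideanSpace ℝ (Fin d)))
    (E' : Set (EuclideanSpace ℝ (Fin d))) : Prop :=
  ∀ C : Set (EuclideanSpace ℝ (Fin d)), IsCompact C →
    Tendsto (fun n => volume (symmDiff (E n) E' ∩ C)) atTop (𝓝 0)

/-- The functional `p(·, Ω)`, a member of a family `p(E, Ω)` of functionals of Lebesgue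
measurable sets `E`, is a perimeter in the reference set `Ω`. (The family enters only in the
invariance under simultaneous translations of `E` and `Ω`.) -/
structure IsPerimeterIn {d : ℕ}
    (p : Set (EuclideanSpace ℝ (Fin d)) → Set (EuclideanSpace ℝ (Fin d)) → ℝ≥0∞)
    (Ω : Set (EuclideanSpace ℝ (Fin d))) : Prop where
  reference_measurable : NullMeasurableSet Ω volume
  reference_pos : 0 < volume Ω
  empty : p ∅ Ω = 0
  congr_null : ∀ E F : Set (EuclideanSpace ℝ (Fin d)),
    NullMeasurableSet E volume → NullMeasurableSet F volume →
    volume (symmDiff E F) = 0 → p E Ω = p F Ω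
  translation : ∀ (E : Set (EuclideanSpace ℝ (Fin d))) (h : EuclideanSpace ℝ (Fin d)),
    NullMeasurableSet E volume →
    p ((fun x => x + h) '' E) ((fun x => x + h) '' Ω) = p E Ω
  finite_of_C2 : ∀ A : Set (EuclideanSpace ℝ (Fin d)),
    IsOpen A → IsCompact (frontier A) → HasC2Boundary A → p (closure A) Ω < ∞
  lowerSemicontinuous : ∀ (E : ℕ → Set (EuclideanSpace ℝ (Fin d)))
    (E' : Set (EuclideanSpace ℝ (Fin d))),
    (∀ n, NullMeasurableSet (E n) volume) → NullMeasurableSet E' volume →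
    ConvergesL1Loc E E' → p E' Ω ≤ liminf (fun n => p (E n) Ω) atTop
  submodular : ∀ E F : Set (EuclideanSpace ℝ (Fin d)),
    NullMeasurableSet E volume → NullMeasurableSet F volume →
    p (E ∩ F) Ω + p (E ∪ F) Ω ≤ p E Ω + p F Ω

end

/-! `Per_K(E, Ω)` weighs by `K (y - x)` the pairs with `x ∉ E`, `y ∈ E`, not both outside `Ω`: it is
`kernelMeasure K (crossing E Ω)`. Submodularity then reduces to inclusions between crossing sets,
and lower semicontinuity to Fatou's lemma.

For finiteness, the substitution `h = y - x` gives `∫ K(h) |crossingSlice E Ω h| dh`. Slices never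
exceed `|Ω|`, so a bound `|{x ∉ E, x + h ∈ E}| ≤ c|h|` for `|h| ≤ 1` suffices
(`nonlocalPerimeter_le_of_slice_le`).

For Caccioppoli sets `c = Per(E)/2`, by testing the perimeter against fields parallel to `h`
(`two_mul_volume_diff_translate_le`). The closure of an open set with compact `C²` boundary may have
infinite measure, so it is treated separately: a segment from `x ∉ E` to `x + h ∈ E` meets the
boundary, hence `x` lies in a tubular neighbourhood. Its volume is linear in the radius `r`, because
about `1/r` disjoint translates of each almost flat piece fit in a fixed ball. -/

section NonlocalPerimeter

variable {d : ℕ}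

local notation "𝔼" => EuclideanSpace ℝ (Fin d)

/-! ### Invariance under null modifications and translations -/

theorem interaction_congr_kernel {K K' : 𝔼 → ℝ≥0∞} (h : K =ᵐ[volume] K') (E F : Set 𝔼) :
    interaction K E F = interaction K' E F := by
  unfold interaction
  refine lintegral_congr fun x => lintegral_congr_ae (ae_restrict_of_ae ?_)
  exact (measurePreserving_sub_right volume x).quasiMeasurePreserving.ae_eq_comp h

theorem interaction_congr_ae (K : 𝔼 → ℝ≥0∞) {E E' F F' : Set 𝔼} (hE : E =ᵐ[volume] E')
    (hF : F =ᵐ[volume] F') : interaction K E F = interaction K E' F' := by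
  unfold interaction
  rw [Measure.restrict_congr_set hE, Measure.restrict_congr_set hF]

theorem nonlocalPerimeter_congr_kernel {K K' : 𝔼 → ℝ≥0∞} (h : K =ᵐ[volume] K') (E Ω : Set 𝔼) :
    nonlocalPerimeter K E Ω = nonlocalPerimeter K' E Ω := by
  simp only [nonlocalPerimeter, interaction_congr_kernel h]

theorem nonlocalPerimeter_congr_ae (K : 𝔼 → ℝ≥0∞) {E E' : Set 𝔼} (Ω : Set 𝔼)
    (hE : E =ᵐ[volume] E') : nonlocalPerimeter K E Ω = nonlocalPerimeter K E' Ω := by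
  have h1 : ∀ S : Set 𝔼, (E ∩ S : Set 𝔼) =ᵐ[volume] (E' ∩ S : Set 𝔼) :=
    fun S => ae_eq_set_inter hE (ae_eq_refl S)
  have h2 : ∀ S : Set 𝔼, (Eᶜ ∩ S : Set 𝔼) =ᵐ[volume] (E'ᶜ ∩ S : Set 𝔼) :=
    fun S => ae_eq_set_inter hE.compl (ae_eq_refl S)
  simp only [nonlocalPerimeter, interaction_congr_ae K (h1 _) (h2 _)]

theorem interaction_translate (K : 𝔼 → ℝ≥0∞) (E F : Set 𝔼) (h : 𝔼) :
    interaction K ((fun x => x + h) '' E) ((fun x => x + h) '' F) = interaction K E F := by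
  have hp := measurePreserving_add_right (volume : Measure 𝔼) h
  have he := measurableEmbedding_addRight h
  unfold interaction
  rw [← hp.setLIntegral_comp_emb he]
  refine lintegral_congr fun x => ?_
  rw [← hp.setLIntegral_comp_emb he]
  simp

theorem nonlocalPerimeter_translate (K : 𝔼 → ℝ≥0∞) (E Ω : Set 𝔼) (h : 𝔼) :
    nonlocalPerimeter K ((fun x => x + h) '' E) ((fun x => x + h) '' Ω)
      = nonlocalPerimeter K E Ω := by
  have hb : Function.Bijective (fun x : 𝔼 => x + h) := (Equiv.addRight h).bijective
  unfold nonlocalPerimeter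
  simp only [← Set.image_compl_eq hb, ← Set.image_inter hb.1, interaction_translate]

/-! ### The nonlocal perimeter as a measure of crossing pairs -/

/-- The measure on pairs `(x, y)` with density `K (y - x)`. -/
noncomputable def kernelMeasure (K : 𝔼 → ℝ≥0∞) : Measure (𝔼 × 𝔼) :=
  (volume.prod volume).withDensity fun p => K (p.2 - p.1)

/-- The pairs `(x, y)` with `x ∉ E` and `y ∈ E` that are not both outside `Ω`. -/
def crossing (E Ω : Set 𝔼) : Set (𝔼 × 𝔼) :=
  {p | p.1 ∉ E ∧ p.2 ∈ E ∧ (p.1 ∈ Ω ∨ p.2 ∈ Ω)}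

theorem measurableSet_crossing {E Ω : Set 𝔼} (hE : MeasurableSet E) (hΩ : MeasurableSet Ω) :
    MeasurableSet (crossing E Ω) :=
  (hE.compl.preimage measurable_fst).inter ((hE.preimage measurable_snd).inter
    ((hΩ.preimage measurable_fst).union (hΩ.preimage measurable_snd)))

theorem interaction_eq_kernelMeasure {K : 𝔼 → ℝ≥0∞} (hK : Measurable K) {E F : Set 𝔼}
    (hE : MeasurableSet E) (hF : MeasurableSet F) :
    interaction K E F = kernelMeasure K (F ×ˢ E) := by
  rw [kernelMeasure, withDensity_apply _ (hF.prod hE), ← Measure.prod_restrict, lintegral_prod]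
  · rfl
  · exact (hK.comp (measurable_snd.sub measurable_fst)).aemeasurable

/-- The three interactions live on disjoint rectangles that partition `crossing E Ω`. -/
theorem nonlocalPerimeter_eq_kernelMeasure {K : 𝔼 → ℝ≥0∞} (hK : Measurable K) {E Ω : Set 𝔼}
    (hE : MeasurableSet E) (hΩ : MeasurableSet Ω) :
    nonlocalPerimeter K E Ω = kernelMeasure K (crossing E Ω) := by
  rw [nonlocalPerimeter, interaction_eq_kernelMeasure hK (hE.inter hΩ) (hE.compl.inter hΩ),
    interaction_eq_kernelMeasure hK (hE.inter hΩ) (hE.compl.inter hΩ.compl),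
    interaction_eq_kernelMeasure hK (hE.inter hΩ.compl) (hE.compl.inter hΩ),
    ← measure_union _ ((hE.compl.inter hΩ.compl).prod (hE.inter hΩ)),
    ← measure_union _ ((hE.compl.inter hΩ).prod (hE.inter hΩ.compl))]
  · congr 1
    ext p
    simp only [crossing, Set.mem_union, Set.mem_prod, Set.mem_inter_iff, Set.mem_compl_iff,
      Set.mem_ofPred_eq]
    tauto
  · rw [Set.disjoint_left]
    intro p
    simp only [Set.mem_union, Set.mem_prod, Set.mem_inter_iff, Set.mem_compl_iff]
    tauto
  · rw [Set.disjoint_left]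
    intro p
    simp only [Set.mem_prod, Set.mem_inter_iff, Set.mem_compl_iff]
    tauto

/-- The slice of `crossing E Ω` along pairs with difference `h`. -/
def crossingSlice (E Ω : Set 𝔼) (h : 𝔼) : Set 𝔼 :=
  {x | x ∉ E ∧ x + h ∈ E ∧ (x ∈ Ω ∨ x + h ∈ Ω)}

theorem nonlocalPerimeter_eq_lintegral_slice {K : 𝔼 → ℝ≥0∞} (hK : Measurable K) {E Ω : Set 𝔼}
    (hE : MeasurableSet E) (hΩ : MeasurableSet Ω) :
    nonlocalPerimeter K E Ω = ∫⁻ h, K h * volume (crossingSlice E Ω h) := by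
  have hW := measurableSet_crossing hE hΩ
  have hshift : Measurable fun p : 𝔼 × 𝔼 => (p.1, p.1 + p.2) :=
    measurable_fst.prodMk (measurable_fst.add measurable_snd)
  rw [nonlocalPerimeter_eq_kernelMeasure hK hE hΩ, kernelMeasure, withDensity_apply _ hW,
    ← lintegral_indicator hW, lintegral_prod]
  swap
  · exact ((hK.comp (measurable_snd.sub measurable_fst)).indicator hW).aemeasurable
  have h1 : ∀ x : 𝔼, ∫⁻ y, (crossing E Ω).indicator (fun p => K (p.2 - p.1)) (x, y)
      = ∫⁻ h, K h * (crossing E Ω).indicator 1 (x, x + h) := by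
    intro x
    rw [← (measurePreserving_add_left volume x).lintegral_comp_emb (measurableEmbedding_addLeft x)]
    refine lintegral_congr fun h => ?_
    by_cases hx : (x, x + h) ∈ crossing E Ω <;> simp [hx]
  simp only [h1]
  rw [lintegral_lintegral_swap]
  · refine lintegral_congr fun h => ?_
    rw [lintegral_const_mul]
    · congr 1
      rw [← lintegral_indicator_one]
      · rfl
      · exact hW.preimage (hshift.comp (measurable_id.prodMk measurable_const))
    · exact (measurable_one.indicator hW).comp
        (hshift.comp (measurable_id.prodMk measurable_const))
  · exact ((hK.comp measurable_snd).mul ((measurable_one.indicator hW).comp hshift)).aemeasurable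

theorem volume_preimage_add_right (S : Set 𝔼) (h : 𝔼) :
    volume {x | x + h ∈ S} = volume S :=
  measure_preimage_add_right volume h S

/-- A point of the slice has `x ∈ Ω \ E` or `x + h ∈ Ω ∩ E`; up to a translation these pieces
partition `Ω`, so the bound is `|Ω|` rather than `2|Ω|`. -/
theorem volume_crossingSlice_le {E Ω : Set 𝔼} (hE : MeasurableSet E) (h : 𝔼) :
    volume (crossingSlice E Ω h) ≤ volume Ω := by
  have hsub : crossingSlice E Ω h ⊆ (Ω \ E) ∪ {x | x + h ∈ Ω ∩ E} := by
    rintro x ⟨h1, h2, h3⟩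
    rcases h3 with h3 | h3
    · exact Or.inl ⟨h3, h1⟩
    · exact Or.inr ⟨h3, h2⟩
  calc volume (crossingSlice E Ω h) ≤ volume (Ω \ E) + volume {x | x + h ∈ Ω ∩ E} :=
        (measure_mono hsub).trans (measure_union_le _ _)
    _ = volume Ω := by
        rw [volume_preimage_add_right, add_comm, measure_inter_add_sdiff _ hE]

/-! ### Submodularity -/

/-- A pair crossing `E ∩ F` or `E ∪ F` crosses `E` or `F`, and a pair crossing both of the former
crosses both of the latter. -/
theorem kernelMeasure_submodular (K : 𝔼 → ℝ≥0∞) {E F Ω : Set 𝔼}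
    (hE : MeasurableSet E) (hF : MeasurableSet F) (hΩ : MeasurableSet Ω) :
    kernelMeasure K (crossing (E ∩ F) Ω) + kernelMeasure K (crossing (E ∪ F) Ω)
      ≤ kernelMeasure K (crossing E Ω) + kernelMeasure K (crossing F Ω) := by
  rw [← measure_union_add_inter _ (measurableSet_crossing (hE.union hF) hΩ),
    ← measure_union_add_inter _ (measurableSet_crossing hF hΩ)]
  refine add_le_add (measure_mono fun p => ?_) (measure_mono fun p => ?_) <;>
  · simp only [crossing, Set.mem_union, Set.mem_inter_iff, Set.mem_ofPred_eq]
    tauto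

theorem nonlocalPerimeter_submodular {K : 𝔼 → ℝ≥0∞} (hK : AEMeasurable K volume) {E F Ω : Set 𝔼}
    (hE : NullMeasurableSet E volume) (hF : NullMeasurableSet F volume) (hΩ : MeasurableSet Ω) :
    nonlocalPerimeter K (E ∩ F) Ω + nonlocalPerimeter K (E ∪ F) Ω
      ≤ nonlocalPerimeter K E Ω + nonlocalPerimeter K F Ω := by
  obtain ⟨E', -, hE', hEE⟩ := hE.exists_measurable_superset_ae_eq
  obtain ⟨F', -, hF', hFF⟩ := hF.exists_measurable_superset_ae_eq
  simp only [nonlocalPerimeter_congr_kernel hK.ae_eq_mk]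
  rw [← nonlocalPerimeter_congr_ae _ Ω hEE, ← nonlocalPerimeter_congr_ae _ Ω hFF,
    ← nonlocalPerimeter_congr_ae _ Ω (ae_eq_set_inter hEE hFF),
    ← nonlocalPerimeter_congr_ae _ Ω (ae_eq_set_union hEE hFF)]
  have hm := hK.measurable_mk
  rw [nonlocalPerimeter_eq_kernelMeasure hm (hE'.inter hF') hΩ,
    nonlocalPerimeter_eq_kernelMeasure hm (hE'.union hF') hΩ,
    nonlocalPerimeter_eq_kernelMeasure hm hE' hΩ, nonlocalPerimeter_eq_kernelMeasure hm hF' hΩ]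
  exact kernelMeasure_submodular _ hE' hF' hΩ

/-! ### Lower semicontinuity -/

theorem kernelMeasure_ae_of_ae {K : 𝔼 → ℝ≥0∞} {P : 𝔼 → Prop} (h : ∀ᵐ x, P x) :
    ∀ᵐ p ∂kernelMeasure K, P p.1 ∧ P p.2 := by
  have h1 : ∀ᵐ p ∂((volume : Measure 𝔼).prod (volume : Measure 𝔼)), P p.1 ∧ P p.2 :=
    (Measure.quasiMeasurePreserving_fst.ae h).and (Measure.quasiMeasurePreserving_snd.ae h)
  exact (withDensity_absolutelyContinuous _ _).ae_le h1

/-- Fatou's lemma for the indicators of the crossing sets. Almost everywhere convergence on points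
passes to pairs because `kernelMeasure K` is absolutely continuous with respect to the product
measure. -/
theorem kernelMeasure_crossing_le_of_ae_eventually (K : 𝔼 → ℝ≥0∞) {E : ℕ → Set 𝔼} {E' Ω : Set 𝔼}
    (hE : ∀ n, MeasurableSet (E n)) (hE' : MeasurableSet E') (hΩ : MeasurableSet Ω)
    (hlim : ∀ᵐ x, ∀ᶠ n in atTop, (x ∈ E n ↔ x ∈ E')) :
    kernelMeasure K (crossing E' Ω) ≤ liminf (fun n => kernelMeasure K (crossing (E n) Ω)) atTop := by
  simp only [← lintegral_indicator_one (measurableSet_crossing hE' hΩ),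
    ← lintegral_indicator_one (measurableSet_crossing (hE _) hΩ)]
  refine le_trans (lintegral_mono_ae ?_) (lintegral_liminf_le fun n =>
    measurable_one.indicator (measurableSet_crossing (hE n) hΩ))
  filter_upwards [kernelMeasure_ae_of_ae hlim] with p hp
  refine le_liminf_of_le (by isBoundedDefault) ?_
  filter_upwards [hp.1, hp.2] with n h1 h2
  have : p ∈ crossing (E n) Ω ↔ p ∈ crossing E' Ω := by
    simp only [crossing, Set.mem_ofPred_eq, h1, h2]
  by_cases hp' : p ∈ crossing E' Ω <;> simp [this, hp']

/-- A sequence converging in `L¹_loc` fast enough converges almost everywhere. -/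
theorem ae_eventually_mem_iff {E : ℕ → Set 𝔼} {E' : Set 𝔼}
    (h : ∀ n, volume (symmDiff (E n) E' ∩ Metric.closedBall 0 n) < 2⁻¹ ^ n) :
    ∀ᵐ x, ∀ᶠ n in atTop, (x ∈ E n ↔ x ∈ E') := by
  have hsum : ∑' n : ℕ, volume (symmDiff (E n) E' ∩ Metric.closedBall 0 (n : ℝ)) ≠ ∞ := by
    refine ne_top_of_le_ne_top ?_ (ENNReal.tsum_le_tsum fun n => (h n).le)
    rw [ENNReal.tsum_geometric]
    simp
  -- Borel–Cantelli; the balls of radius `n` eventually contain any given `x`, so the localization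
  -- disappears.
  have hae := ae_finite_setOfPred_mem hsum
  filter_upwards [hae] with x hx
  have h1 : ∀ᶠ n in atTop, x ∉ symmDiff (E n) E' ∩ Metric.closedBall 0 (n : ℝ) := by
    rw [← Nat.cofinite_eq_atTop]
    simpa [Filter.Eventually, Filter.mem_cofinite, Set.compl_ofPred] using hx
  filter_upwards [h1, eventually_ge_atTop ⌈‖x‖⌉₊] with n hn hxn
  have hxb : x ∈ Metric.closedBall (0 : 𝔼) (n : ℝ) := by
    simpa using Nat.ceil_le.1 hxn
  have : x ∉ symmDiff (E n) E' := fun h' => hn ⟨h', hxb⟩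
  rw [Set.mem_symmDiff] at this
  tauto

theorem ConvergesL1Loc.congr_ae {E F : ℕ → Set 𝔼} {E' F' : Set 𝔼} (h : ConvergesL1Loc E E')
    (hE : ∀ n, E n =ᵐ[volume] F n) (hE' : E' =ᵐ[volume] F') : ConvergesL1Loc F F' := by
  intro C hC
  refine (h C hC).congr fun n => measure_congr ?_
  exact ae_eq_set_inter (ae_eq_set_symmDiff (hE n) hE') (ae_eq_refl C)

theorem kernelMeasure_crossing_lsc (K : 𝔼 → ℝ≥0∞) {E : ℕ → Set 𝔼} {E' Ω : Set 𝔼}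
    (hE : ∀ n, MeasurableSet (E n)) (hE' : MeasurableSet E') (hΩ : MeasurableSet Ω)
    (hlim : ConvergesL1Loc E E') :
    kernelMeasure K (crossing E' Ω) ≤ liminf (fun n => kernelMeasure K (crossing (E n) Ω)) atTop := by
  by_contra! hlt
  obtain ⟨c, hc1, hc2⟩ := exists_between hlt
  have hfreq : ∃ᶠ n in atTop, kernelMeasure K (crossing (E n) Ω) < c :=
    frequently_lt_of_liminf_lt (by isBoundedDefault) hc1
  -- If the inequality failed, some subsequence would keep its values below `c` and converge fast
  -- enough to converge almost everywhere.
  have hP : ∀ k : ℕ, ∃ᶠ n in atTop, kernelMeasure K (crossing (E n) Ω) < c ∧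
      volume (symmDiff (E n) E' ∩ Metric.closedBall 0 (k : ℝ)) < 2⁻¹ ^ k := by
    intro k
    refine hfreq.and_eventually ?_
    exact (hlim _ (isCompact_closedBall 0 (k : ℝ))).eventually_lt_const
      (ENNReal.pow_pos (by simp) k)
  obtain ⟨φ, -, hφ⟩ := extraction_forall_of_frequently hP
  have hle := kernelMeasure_crossing_le_of_ae_eventually K (fun n => hE (φ n)) hE' hΩ
    (ae_eventually_mem_iff fun n => (hφ n).2)
  refine absurd (hle.trans ?_) (not_le.2 hc2)
  exact liminf_le_of_frequently_le' (Frequently.of_forall fun n => (hφ n).1.le)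

theorem nonlocalPerimeter_lsc {K : 𝔼 → ℝ≥0∞} (hK : AEMeasurable K volume)
    {E : ℕ → Set 𝔼} {E' Ω : Set 𝔼} (hE : ∀ n, NullMeasurableSet (E n) volume)
    (hE' : NullMeasurableSet E' volume) (hΩ : MeasurableSet Ω) (hlim : ConvergesL1Loc E E') :
    nonlocalPerimeter K E' Ω ≤ liminf (fun n => nonlocalPerimeter K (E n) Ω) atTop := by
  choose F _ hF hEF using fun n => (hE n).exists_measurable_superset_ae_eq
  obtain ⟨F', -, hF', hEF'⟩ := hE'.exists_measurable_superset_ae_eq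
  simp only [nonlocalPerimeter_congr_kernel hK.ae_eq_mk, ← nonlocalPerimeter_congr_ae _ Ω hEF',
    ← nonlocalPerimeter_congr_ae _ Ω (hEF _)]
  simp only [nonlocalPerimeter_eq_kernelMeasure hK.measurable_mk hF' hΩ,
    nonlocalPerimeter_eq_kernelMeasure hK.measurable_mk (hF _) hΩ]
  exact kernelMeasure_crossing_lsc _ hF hF' hΩ
    (hlim.congr_ae (fun n => (hEF n).symm) hEF'.symm)

/-! ### From slice estimates to the nonlocal perimeter -/

/-- A bound `|h|`-linear at the origin on the measure of the slices bounds the nonlocal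
perimeter. -/
theorem nonlocalPerimeter_le_of_slice_le {K : 𝔼 → ℝ≥0} (hK : AEMeasurable K volume)
    (hKi : Integrable (fun h => (K h : ℝ) * min 1 ‖h‖) volume) {E Ω : Set 𝔼}
    (hE : MeasurableSet E) (hΩ : MeasurableSet Ω) (c : ℝ≥0∞)
    (hc : ∀ h : 𝔼, ‖h‖ ≤ 1 → volume {x | x ∉ E ∧ x + h ∈ E} ≤ c * ENNReal.ofReal ‖h‖) :
    nonlocalPerimeter (fun h => (K h : ℝ≥0∞)) E Ω
      ≤ max c (volume Ω) * ENNReal.ofReal (∫ h, (K h : ℝ) * min 1 ‖h‖) := by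
  have hKe : AEMeasurable (fun h => (K h : ℝ≥0∞)) volume := hK.coe_nnreal_ennreal
  have hmin : ∀ h : 𝔼, 0 ≤ min 1 ‖h‖ := fun h => le_min zero_le_one (norm_nonneg h)
  rw [nonlocalPerimeter_congr_kernel hKe.ae_eq_mk,
    nonlocalPerimeter_eq_lintegral_slice hKe.measurable_mk hE hΩ,
    ofReal_integral_eq_lintegral_ofReal hKi
      (ae_of_all _ fun h => mul_nonneg (NNReal.coe_nonneg (K h)) (hmin h)),
    ← lintegral_const_mul'' _ hKi.aemeasurable.ennreal_ofReal]
  refine lintegral_mono_ae ?_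
  filter_upwards [hKe.ae_eq_mk] with h hh
  rw [← hh, ENNReal.ofReal_mul (NNReal.coe_nonneg (K h)), ENNReal.ofReal_coe_nnreal, mul_left_comm]
  gcongr
  rcases le_total ‖h‖ 1 with h1 | h1
  · rw [min_eq_right h1]
    refine (measure_mono fun x hx => ?_).trans ((hc h h1).trans ?_)
    · exact ⟨hx.1, hx.2.1⟩
    · gcongr
      exact le_max_left _ _
  · rw [min_eq_left h1, ENNReal.ofReal_one, mul_one]
    exact (volume_crossingSlice_le hE h).trans (le_max_right _ _)

/-! ### The translation estimate for sets of finite perimeter -/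

theorem exists_contDiff_cutoff {K U : Set 𝔼} (hK : IsCompact K) (hU : IsOpen U) (hKU : K ⊆ U) :
    ∃ g : 𝔼 → ℝ, ContDiff ℝ 1 g ∧ HasCompactSupport g ∧ (∀ x, g x ∈ Set.Icc (0 : ℝ) 1) ∧
      (∀ x ∈ K, g x = 1) ∧ ∀ x, x ∉ U → g x = 0 := by
  obtain ⟨V, hVo, hKV, hVU, hVc⟩ := exists_open_between_and_isCompact_closure hK hU hKU
  obtain ⟨f, hf0, hf1, hf⟩ := exists_contMDiffMap_zero_one_of_isClosed (n := 1)
    (modelWithCornersSelf ℝ 𝔼) hVo.isClosed_compl hK.isClosed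
    (Set.disjoint_left.2 fun x hx hxK => hx (hKV hxK))
  have hz : ∀ x, x ∉ V → f x = 0 := fun x hx => hf0 hx
  refine ⟨f, f.contMDiff.contDiff, ?_, hf, fun x hx => hf1 hx, fun x hx => hz x fun hxV =>
    hx (hVU (subset_closure hxV))⟩
  exact HasCompactSupport.intro hVc fun x hx => hz x fun hxV => hx (subset_closure hxV)

/-- Smooth form of `L¹` duality: `g` approximates `χ_A - χ_B` as a difference of two cutoffs. Each
cutoff contributes an error `ε / 4` on `A` and another on `B`. -/
theorem exists_contDiff_approx_sign {A B : Set 𝔼} (hA : MeasurableSet A) (hB : MeasurableSet B)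
    (hA' : volume A ≠ ∞) (hB' : volume B ≠ ∞) (hAB : Disjoint A B) {ε : ℝ} (hε : 0 < ε) :
    ∃ g : 𝔼 → ℝ, ContDiff ℝ 1 g ∧ HasCompactSupport g ∧ (∀ x, |g x| ≤ 1) ∧
      volume.real A + volume.real B - ε ≤ (∫ x in A, g x) - ∫ x in B, g x := by
  have key : ∀ {S T : Set 𝔼}, MeasurableSet S → MeasurableSet T → volume S ≠ ∞ → volume T ≠ ∞ →
      Disjoint S T → ∃ g : 𝔼 → ℝ, ContDiff ℝ 1 g ∧ HasCompactSupport g ∧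
        (∀ x, g x ∈ Set.Icc (0 : ℝ) 1) ∧ volume.real S - ε / 4 ≤ ∫ x in S, g x ∧
        ∫ x in T, g x ≤ ε / 4 := by
    intro S T hS hT hS' hT' hST
    have hε' : ENNReal.ofReal (ε / 4) ≠ 0 := by simpa using hε
    obtain ⟨C, hCS, hC, hCε⟩ := hS.exists_isCompact_sdiff_lt hS' hε'
    obtain ⟨U, hSU, hU, hU', hUε⟩ := hS.exists_isOpen_sdiff_lt hS' hε'
    obtain ⟨g, hg, hgc, hg01, hg1, hg0⟩ := exists_contDiff_cutoff hC hU (hCS.trans hSU)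
    have hint : Integrable g volume := hg.continuous.integrable_of_hasCompactSupport hgc
    refine ⟨g, hg, hgc, hg01, ?_, ?_⟩
    · have h1 : volume.real S - ε / 4 ≤ volume.real C := by
        have h2 : volume.real (S \ C) < ε / 4 := by
          rw [Measure.real]
          exact ENNReal.toReal_lt_of_lt_ofReal hCε
        have h3 := measureReal_sdiff_add_inter (μ := volume) (s := S) hC.measurableSet hS'
        rw [Set.inter_eq_self_of_subset_right hCS] at h3
        linarith
      have h4 : ∫ x in C, g x = volume.real C := by
        rw [setIntegral_congr_fun hC.measurableSet (g := fun _ => (1 : ℝ)) fun x hx => hg1 x hx]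
        simp
      have h5 : ∫ x in C, g x ≤ ∫ x in S, g x :=
        setIntegral_mono_set hint.integrableOn (ae_of_all _ fun x => (hg01 x).1)
          (LE.le.eventuallyLE hCS)
      linarith
    · have h1 : ∫ x in T, g x ≤ ∫ x in T, U.indicator (fun _ => (1 : ℝ)) x := by
        refine setIntegral_mono hint.integrableOn ?_ fun x => ?_
        · exact ((integrable_indicator_iff hU.measurableSet).2
            (integrableOn_const hU'.ne)).integrableOn
        · by_cases hx : x ∈ U
          · simpa [hx] using (hg01 x).2
          · simp [hx, hg0 x hx]
      rw [setIntegral_indicator hU.measurableSet] at h1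
      simp only [setIntegral_const, smul_eq_mul, mul_one] at h1
      refine h1.trans ?_
      have h2 : T ∩ U ⊆ U \ S := fun x hx => ⟨hx.2, fun hxS => Set.disjoint_left.1 hST hxS hx.1⟩
      have h3 : volume (T ∩ U) < ENNReal.ofReal (ε / 4) := (measure_mono h2).trans_lt hUε
      exact (ENNReal.toReal_lt_of_lt_ofReal h3).le
  obtain ⟨f, hf, hfc, hf01, hfA, hfB⟩ := key hA hB hA' hB' hAB
  obtain ⟨g, hg, hgc, hg01, hgB, hgA⟩ := key hB hA hB' hA' hAB.symm
  have hfi : Integrable f volume := hf.continuous.integrable_of_hasCompactSupport hfc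
  have hgi : Integrable g volume := hg.continuous.integrable_of_hasCompactSupport hgc
  refine ⟨fun x => f x - g x, hf.sub hg, hfc.sub hgc, fun x => ?_, ?_⟩
  · rw [abs_le]
    constructor <;> linarith [(hf01 x).1, (hf01 x).2, (hg01 x).1, (hg01 x).2]
  · rw [integral_sub hfi.integrableOn hgi.integrableOn,
      integral_sub hfi.integrableOn hgi.integrableOn]
    linarith

/-- The average of `g` over the segment from `x - h` to `x`. -/
noncomputable def segmentAverage (g : 𝔼 → ℝ) (h x : 𝔼) : ℝ := ∫ t in (0 : ℝ)..1, g (x - t • h)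

/-- The average is the convolution of `g` with the image of Lebesgue measure on `(0, 1]` under `t ↦
t • h`, so its regularity is inherited from `g`. -/
theorem contDiff_segmentAverage {g : 𝔼 → ℝ} (hg : ContDiff ℝ 1 g) (hgc : HasCompactSupport g)
    (h : 𝔼) : ContDiff ℝ 1 (segmentAverage g h) := by
  set μ : Measure 𝔼 := (volume.restrict (Set.Ioc (0 : ℝ) 1)).map fun t => t • h
  have hm : Measurable fun t : ℝ => t • h := measurable_id.smul_const h
  have : IsFiniteMeasure μ := by
    have : IsFiniteMeasure (volume.restrict (Set.Ioc (0 : ℝ) 1)) := ⟨by simp⟩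
    infer_instance
  have hc := hgc.contDiff_convolution_right (n := 1) (f := fun _ => (1 : ℝ)) (μ := μ)
    (ContinuousLinearMap.mul ℝ ℝ) (integrable_const _).locallyIntegrable hg
  have heq : segmentAverage g h = convolution (fun _ => (1 : ℝ)) g
      (ContinuousLinearMap.mul ℝ ℝ) μ := by
    funext x
    rw [segmentAverage, intervalIntegral.integral_of_le zero_le_one, convolution, integral_map]
    · simp
    · exact hm.aemeasurable
    · refine Continuous.aestronglyMeasurable ?_
      have := hg.continuous
      simp only [ContinuousLinearMap.mul_apply', one_mul]
      fun_prop
  rw [heq]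
  exact hc

theorem hasCompactSupport_segmentAverage {g : 𝔼 → ℝ} (hgc : HasCompactSupport g) (h : 𝔼) :
    HasCompactSupport (segmentAverage g h) := by
  have hcomp : IsCompact ((fun p : ℝ × 𝔼 => p.2 + p.1 • h) '' (Set.Icc 0 1 ×ˢ tsupport g)) :=
    (isCompact_Icc.prod hgc).image (by fun_prop)
  refine HasCompactSupport.intro hcomp fun x hx => ?_
  rw [segmentAverage, intervalIntegral.integral_of_le zero_le_one]
  refine setIntegral_eq_zero_of_forall_eq_zero fun t ht => ?_
  by_contra hne
  exact hx ⟨(t, x - t • h), ⟨⟨ht.1.le, ht.2⟩, subset_tsupport _ hne⟩, by simp⟩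

theorem abs_segmentAverage_le {g : 𝔼 → ℝ} (hg : ∀ x, |g x| ≤ 1) (h x : 𝔼) :
    |segmentAverage g h x| ≤ 1 := by
  have := intervalIntegral.norm_integral_le_of_norm_le_const (a := 0) (b := 1) (C := 1)
    (f := fun t : ℝ => g (x - t • h)) fun t _ => hg _
  simpa [segmentAverage] using this

/-- On the line `x + s • h` the average is the integral of `γ` over `[s - 1, s]`; its derivative at
`s = 0` is the difference of the endpoint values. -/
theorem fderiv_segmentAverage {g : 𝔼 → ℝ} (hg : ContDiff ℝ 1 g) (hgc : HasCompactSupport g)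
    (h x : 𝔼) : fderiv ℝ (segmentAverage g h) x h = g x - g (x - h) := by
  set γ : ℝ → ℝ := fun s => g (x + s • h) with hγ
  have hγc : Continuous γ := by
    have := hg.continuous
    fun_prop
  have hline : ∀ s : ℝ, segmentAverage g h (x + s • h)
      = (∫ t in (0 : ℝ)..s, γ t) - ∫ t in (0 : ℝ)..(s - 1), γ t := by
    intro s
    have h1 : segmentAverage g h (x + s • h) = ∫ t in (0 : ℝ)..1, γ (s - t) := by
      refine intervalIntegral.integral_congr fun t _ => ?_
      simp only [hγ, sub_smul]
      congr 1
      abel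
    rw [h1, intervalIntegral.integral_comp_sub_left, sub_zero,
      intervalIntegral.integral_interval_sub_left] <;>
    exact hγc.intervalIntegrable _ _
  have hF : ∀ s : ℝ, HasDerivAt (fun u => ∫ t in (0 : ℝ)..u, γ t) (γ s) s := fun s =>
    intervalIntegral.integral_hasDerivAt_right (hγc.intervalIntegrable _ _)
      hγc.stronglyMeasurable.stronglyMeasurableAtFilter hγc.continuousAt
  have hF1 : HasDerivAt (fun u => ∫ t in (0 : ℝ)..(u - 1), γ t) (γ (0 - 1)) 0 :=
    HasDerivAt.comp_sub_const 0 1 (hF (0 - 1))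
  have hd1 : HasDerivAt (fun s : ℝ => segmentAverage g h (x + s • h)) (γ 0 - γ (0 - 1)) 0 := by
    simp only [hline]
    exact (hF 0).sub hF1
  have hdiff : HasFDerivAt (segmentAverage g h) (fderiv ℝ (segmentAverage g h) x) x :=
    ((contDiff_segmentAverage hg hgc h).differentiable one_ne_zero x).hasFDerivAt
  have hd2 : HasDerivAt (fun s : ℝ => segmentAverage g h (x + s • h))
      (fderiv ℝ (segmentAverage g h) x h) 0 := hdiff.hasLineDerivAt h
  rw [hd2.unique hd1]
  simp [hγ, sub_eq_add_neg]

theorem divergence_smul_const {G : 𝔼 → ℝ} {x : 𝔼} (hG : DifferentiableAt ℝ G x) (w : 𝔼) :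
    divergence (fun y => G y • w) x = fderiv ℝ G x w := by
  unfold divergence
  rw [fderiv_smul_const hG]
  conv_rhs => rw [← (EuclideanSpace.basisFun (Fin d) ℝ).sum_repr w, map_sum]
  refine Finset.sum_congr rfl fun i _ => ?_
  simp [mul_comm]

/-- The field `-(segmentAverage g h) h/|h|` is admissible, and its divergence is exactly the
difference quotient `(g (x - h) - g x)/|h|`. -/
theorem integral_sub_translate_le_perimeter {g : 𝔼 → ℝ} (hg : ContDiff ℝ 1 g)
    (hgc : HasCompactSupport g) (hg1 : ∀ x, |g x| ≤ 1) (E : Set 𝔼) {h : 𝔼} (hh : h ≠ 0) :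
    ENNReal.ofReal (∫ x in E, (g (x - h) - g x)) ≤ ENNReal.ofReal ‖h‖ * perimeter E := by
  have hn : 0 < ‖h‖ := norm_pos_iff.2 hh
  set w : 𝔼 := -(‖h‖⁻¹ • h) with hw
  have hw1 : ‖w‖ = 1 := by
    rw [hw, norm_neg, norm_smul, norm_inv, norm_norm, inv_mul_cancel₀ hn.ne']
  have hG := contDiff_segmentAverage hg hgc h
  set φ : 𝔼 → 𝔼 := fun y => segmentAverage g h y • w with hφ
  have hdiv : ∀ x, divergence φ x = ‖h‖⁻¹ * (g (x - h) - g x) := by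
    intro x
    rw [hφ, divergence_smul_const (hG.differentiable one_ne_zero x), hw, map_neg, map_smul,
      fderiv_segmentAverage hg hgc, smul_eq_mul]
    ring
  have hle : ENNReal.ofReal (∫ x in E, divergence φ x) ≤ perimeter E := by
    refine le_iSup₂_of_le φ ⟨?_, ?_, ?_⟩ le_rfl
    · exact hG.smul contDiff_const
    · exact (hasCompactSupport_segmentAverage hgc h).smul_right
    · intro x
      rw [hφ, norm_smul, hw1, mul_one]
      exact abs_segmentAverage_le hg1 h x
  simp only [hdiv, integral_const_mul] at hle
  calc ENNReal.ofReal (∫ x in E, (g (x - h) - g x))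
      = ENNReal.ofReal ‖h‖ * ENNReal.ofReal (‖h‖⁻¹ * ∫ x in E, (g (x - h) - g x)) := by
        rw [← ENNReal.ofReal_mul hn.le, mul_inv_cancel_left₀ hn.ne']
    _ ≤ _ := by gcongr

/-- The translation estimate for the characteristic function of a set of finite perimeter. -/
theorem two_mul_volume_diff_translate_le {E : Set 𝔼} (hE : MeasurableSet E) (hE' : volume E ≠ ∞)
    (h : 𝔼) :
    2 * volume {x | x ∉ E ∧ x + h ∈ E} ≤ ENNReal.ofReal ‖h‖ * perimeter E := by
  rcases eq_or_ne h 0 with rfl | hh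
  · simp
  set T : Set 𝔼 := {x | x + h ∈ E} with hT
  have hTm : MeasurableSet T := hE.preimage (measurable_add_const h)
  have hTv : volume T = volume E := volume_preimage_add_right E h
  have hT' : volume T ≠ ∞ := hTv ▸ hE'
  have hA : {x | x ∉ E ∧ x + h ∈ E} = T \ E := by
    ext x
    exact and_comm
  rw [hA]
  have hTE' : volume (T \ E) ≠ ∞ := measure_ne_top_of_subset Set.sdiff_subset hT'
  have hET' : volume (E \ T) ≠ ∞ := measure_ne_top_of_subset Set.sdiff_subset hE'
  -- Since `|T| = |E|`, both halves of the symmetric difference have the same measure; this is the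
  -- source of the factor `2`.
  have hreal : volume.real (T \ E) = volume.real (E \ T) := by
    have h1 := measureReal_sdiff_add_inter (μ := volume) (s := T) hE hT'
    have h2 := measureReal_sdiff_add_inter (μ := volume) (s := E) hTm hE'
    have h3 : volume.real T = volume.real E := by simp [Measure.real, hTv]
    rw [Set.inter_comm] at h1
    linarith
  have hmain : ∀ ε : ℝ, 0 < ε → 2 * volume (T \ E)
      ≤ ENNReal.ofReal ‖h‖ * perimeter E + ENNReal.ofReal ε := by
    intro ε hε
    obtain ⟨g, hg, hgc, hg1, hgε⟩ := exists_contDiff_approx_sign (hTm.diff hE) (hE.diff hTm)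
      hTE' hET' (Set.disjoint_left.2 fun x hx hx' => hx.2 hx'.1) hε
    have hgi : Integrable g volume := hg.continuous.integrable_of_hasCompactSupport hgc
    have hgi' : Integrable (fun x => g (x - h)) volume := hgi.comp_sub_right h
    have hdiff : (∫ x in T \ E, g x) - ∫ x in E \ T, g x = ∫ x in E, (g (x - h) - g x) := by
      have h1 := integral_inter_add_sdiff (f := g) (s := T) hE (hgi.integrableOn (s := T))
      have h2 := integral_inter_add_sdiff (f := g) (s := E) hTm (hgi.integrableOn (s := E))
      have h3 : ∫ x in T, g x = ∫ x in E, g (x - h) := by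
        have := (measurePreserving_add_right (volume : Measure 𝔼) h).setIntegral_preimage_emb
          (measurableEmbedding_addRight h) (fun x => g (x - h)) E
        simp only [add_sub_cancel_right] at this
        exact this
      rw [Set.inter_comm] at h1
      rw [integral_sub hgi'.integrableOn hgi.integrableOn, ← h3]
      linarith
    have hper := integral_sub_translate_le_perimeter hg hgc hg1 E hh
    rw [← hdiff] at hper
    calc 2 * volume (T \ E) = ENNReal.ofReal (volume.real (T \ E) + volume.real (E \ T)) := by
          rw [← hreal, ← two_mul, ENNReal.ofReal_mul zero_le_two, ofReal_measureReal hTE']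
          simp
      _ ≤ ENNReal.ofReal (((∫ x in T \ E, g x) - ∫ x in E \ T, g x) + ε) := by
          exact ENNReal.ofReal_le_ofReal (by linarith)
      _ ≤ _ := ENNReal.ofReal_add_le
      _ ≤ _ := by gcongr
  refine ENNReal.le_of_forall_pos_le_add fun ε hε _ => ?_
  simpa using hmain ε hε

theorem perimeter_congr_ae {E F : Set 𝔼} (h : E =ᵐ[volume] F) : perimeter E = perimeter F := by
  simp only [perimeter, setIntegral_congr_set h]

/-! ### Volume of tubular neighbourhoods of a `C²` boundary -/

/-- If the differences of points of a bounded set `S` are almost annihilated by a nonzero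
functional `L`, then tubular neighbourhoods of `S` have at most linear volume. -/
theorem exists_volume_thickening_le_of_almost_flat {V : Type*} [NormedAddCommGroup V]
    [NormedSpace ℝ V] [FiniteDimensional ℝ V] [MeasurableSpace V] [BorelSpace V]
    (μ : Measure V) [μ.IsAddHaarMeasure]
    (L : V →L[ℝ] ℝ) {w : V} (hw : L w = 1) {S : Set V} (hSb : Bornology.IsBounded S)
    (hS : ∀ y ∈ S, ∀ z ∈ S, ‖w‖ * |L (y - z)| ≤ ‖y - z‖ / 2) :
    ∃ C : ℝ≥0∞, C ≠ ∞ ∧ ∀ r : ℝ, 0 < r → r ≤ 1 →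
      μ (Metric.thickening r S) ≤ C * ENNReal.ofReal r := by
  obtain ⟨R, hR⟩ := hSb.subset_closedBall 0
  have hw0 : 0 < ‖w‖ := norm_pos_iff.2 fun h => by simp [h] at hw
  have hLw : 1 ≤ ‖L‖ * ‖w‖ := by simpa [hw] using L.le_opNorm w
  -- Translates spaced by `M * r` along `w` are disjoint as soon as `M > 6 * ‖L‖`: an overlap would
  -- give `m * M ≤ 6 * ‖L‖` with `m ≥ 1`.
  set M : ℝ := 7 * ‖L‖ with hM
  have hL0 : 0 < ‖L‖ := by
    by_contra hcon
    have : ‖L‖ * ‖w‖ ≤ 0 := mul_nonpos_of_nonpos_of_nonneg (not_lt.1 hcon) hw0.le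
    linarith
  -- Room for `S`, a thickening by `r ≤ 1`, and shifts of length at most `N * r * M * ‖w‖ ≤ 2 * M *
  -- ‖w‖`.
  set B : Set V := Metric.closedBall 0 (R + 1 + 2 * M * ‖w‖) with hB
  have hBfin : μ B ≠ ∞ := (isCompact_closedBall _ _).measure_ne_top
  refine ⟨μ B, hBfin, fun r hr hr1 => ?_⟩
  set N : ℕ := ⌈r⁻¹⌉₊ with hN
  have hN1 : r⁻¹ ≤ N := Nat.le_ceil _
  have hN2 : (N : ℝ) < r⁻¹ + 1 := Nat.ceil_lt_add_one (inv_nonneg.2 hr.le)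
  have hNr : (N : ℝ) * r ≤ 2 := by
    have : (N : ℝ) * r ≤ (r⁻¹ + 1) * r := by gcongr
    rw [add_mul, inv_mul_cancel₀ hr.ne'] at this
    linarith
  set T : ℕ → Set V := fun k => (fun x => x + ((k : ℝ) * M * r) • w) '' Metric.thickening r S
    with hT
  have hTm : ∀ k, MeasurableSet (T k) := fun k =>
    (measurableEmbedding_addRight _).measurableSet_image.2 Metric.isOpen_thickening.measurableSet
  have hTv : ∀ k, μ (T k) = μ (Metric.thickening r S) := fun k => by
    rw [hT]
    simp [Set.image_add_right]
  have hTB : ∀ k ∈ Finset.range N, T k ⊆ B := by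
    rintro k hk _ ⟨x, hx, rfl⟩
    obtain ⟨s, hs, hxs⟩ := Metric.mem_thickening_iff.1 hx
    have h1 : ‖s‖ ≤ R := by simpa using hR hs
    have h2 : ‖x - s‖ < r := by rwa [← dist_eq_norm]
    have hkN : (k : ℝ) ≤ N := by exact_mod_cast (Finset.mem_range.1 hk).le
    have h3 : ‖((k : ℝ) * M * r) • w‖ ≤ 2 * M * ‖w‖ := by
      rw [norm_smul, Real.norm_of_nonneg (by positivity)]
      refine mul_le_mul_of_nonneg_right ?_ hw0.le
      calc (k : ℝ) * M * r = (k * r) * M := by ring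
        _ ≤ (N * r) * M := by gcongr
        _ ≤ 2 * M := by gcongr
    have h4 : ‖x‖ ≤ ‖x - s‖ + ‖s‖ := by simpa using norm_add_le (x - s) s
    rw [hB, mem_closedBall_zero_iff]
    linarith [norm_add_le x (((k : ℝ) * M * r) • w)]
  have hdisj : ∀ j k : ℕ, j < k → Disjoint (T j) (T k) := by
    intro j k hjk
    rw [Set.disjoint_left]
    rintro _ ⟨x, hx, rfl⟩ ⟨y, hy, hxy⟩
    obtain ⟨s, hs, hxs⟩ := Metric.mem_thickening_iff.1 hx
    obtain ⟨t, ht, hyt⟩ := Metric.mem_thickening_iff.1 hy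
    rw [dist_eq_norm] at hxs hyt
    set m : ℝ := (k : ℝ) - j with hm
    have hm1 : 1 ≤ m := by
      have : (j : ℝ) + 1 ≤ k := by exact_mod_cast hjk
      linarith
    set e : V := (y - t) - (x - s) with he
    have hen : ‖e‖ ≤ 2 * r := by linarith [norm_sub_le (y - t) (x - s)]
    have hst : s - t = (m * M * r) • w + e := by
      have : x = y + ((k : ℝ) * M * r) • w - ((j : ℝ) * M * r) • w := by
        rw [eq_sub_iff_add_eq]
        exact hxy.symm
      rw [he, this, hm, sub_mul, sub_mul, sub_smul]
      abel
    have h1 : ‖s - t‖ ≤ m * M * r * ‖w‖ + 2 * r := by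
      rw [hst]
      refine (norm_add_le _ _).trans ?_
      rw [norm_smul, Real.norm_of_nonneg (by positivity)]
      linarith
    have h2 : m * M * r - 2 * r * ‖L‖ ≤ |L (s - t)| := by
      rw [hst, map_add, map_smul, hw, smul_eq_mul, mul_one]
      have h3 : |L e| ≤ ‖L‖ * (2 * r) := (L.le_opNorm e).trans (by gcongr)
      have := neg_abs_le (L e)
      have := le_abs_self (m * M * r + L e)
      linarith
    have h3 := hS s hs t ht
    have h4 : ‖w‖ * (m * M * r - 2 * r * ‖L‖) ≤ (m * M * r * ‖w‖ + 2 * r) / 2 :=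
      (mul_le_mul_of_nonneg_left h2 hw0.le).trans (h3.trans (by linarith))
    have h5 : r * 1 ≤ r * (‖L‖ * ‖w‖) := by gcongr
    have h6 : 1 * (‖L‖ * ‖w‖ * r) ≤ m * (‖L‖ * ‖w‖ * r) := by gcongr
    have h7 : 0 < ‖L‖ * ‖w‖ * r := by positivity
    rw [hM] at h4
    nlinarith
  have hsum : (N : ℝ≥0∞) * μ (Metric.thickening r S) ≤ μ B := by
    calc (N : ℝ≥0∞) * μ (Metric.thickening r S) = ∑ k ∈ Finset.range N, μ (T k) := by
          simp [hTv]
      _ = μ (⋃ k ∈ Finset.range N, T k) := by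
          rw [measure_biUnion_finset _ fun k _ => hTm k]
          intro j _ k _ hjk
          rcases lt_or_gt_of_ne hjk with h | h
          · exact hdisj j k h
          · exact (hdisj k j h).symm
      _ ≤ μ B := measure_mono (Set.iUnion₂_subset hTB)
  have hone : 1 ≤ ENNReal.ofReal r * N := by
    rw [← ENNReal.ofReal_natCast, ← ENNReal.ofReal_mul hr.le, ENNReal.one_le_ofReal]
    calc (1 : ℝ) = r * r⁻¹ := (mul_inv_cancel₀ hr.ne').symm
      _ ≤ r * N := by gcongr
  calc μ (Metric.thickening r S) ≤ (ENNReal.ofReal r * N) * μ (Metric.thickening r S) :=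
        le_mul_of_one_le_left' hone
    _ = ENNReal.ofReal r * (N * μ (Metric.thickening r S)) := mul_assoc _ _ _
    _ ≤ ENNReal.ofReal r * μ B := by gcongr
    _ = _ := mul_comm _ _

/-- A level set of a strictly differentiable function is almost flat near a regular point. -/
theorem exists_nhds_almost_flat {V : Type*} [NormedAddCommGroup V] [NormedSpace ℝ V]
    {ψ : V → ℝ} {L : V →L[ℝ] ℝ} {x : V} (hψ : HasStrictFDerivAt ψ L x) (hL : L ≠ 0) :
    ∃ w : V, L w = 1 ∧ ∃ O ∈ 𝓝 x, ∀ y ∈ O, ∀ z ∈ O, ψ y = 0 → ψ z = 0 →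
      ‖w‖ * |L (y - z)| ≤ ‖y - z‖ / 2 := by
  obtain ⟨v, hv⟩ : ∃ v, L v ≠ 0 := by
    by_contra! hcon
    exact hL (ContinuousLinearMap.ext hcon)
  set w : V := (L v)⁻¹ • v with hwdef
  have hw : L w = 1 := by simp [hwdef, hv]
  have hw0 : 0 < ‖w‖ := norm_pos_iff.2 fun h => by simp [h] at hw
  refine ⟨w, hw, ?_⟩
  -- On the zero set, strict differentiability reads `|L (y - z)| ≤ ε ‖y - z‖`; this `ε` turns it
  -- into the required flatness.
  have hε : 0 < (2 * ‖w‖)⁻¹ := by positivity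
  have hev := hψ.isLittleO.def hε
  rw [nhds_prod_eq] at hev
  obtain ⟨O, hO, hOp⟩ := (Filter.eventually_prod_self_iff'.1 hev)
  refine ⟨O, hO, fun y hy z hz hy0 hz0 => ?_⟩
  have h1 := hOp y hy z hz
  simp only [hy0, hz0, sub_zero, zero_sub, norm_neg, Real.norm_eq_abs] at h1
  calc ‖w‖ * |L (y - z)| ≤ ‖w‖ * ((2 * ‖w‖)⁻¹ * ‖y - z‖) := by gcongr
    _ = ‖y - z‖ / 2 := by field_simp

theorem HasC2Boundary.exists_nhds_volume_thickening_le {A : Set 𝔼} (hA : HasC2Boundary A) {x : 𝔼}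
    (hx : x ∈ frontier A) :
    ∃ O ∈ 𝓝 x, ∃ C : ℝ≥0∞, C ≠ ∞ ∧ ∀ r : ℝ, 0 < r → r ≤ 1 →
      volume (Metric.thickening r (frontier A ∩ O)) ≤ C * ENNReal.ofReal r := by
  obtain ⟨U, ψ, hU, hxU, hψ, hd, hfr⟩ := hA x hx
  have hstrict : HasStrictFDerivAt ψ (fderiv ℝ ψ x) x :=
    (hψ.contDiffAt (hU.mem_nhds hxU)).hasStrictFDerivAt (by norm_num)
  obtain ⟨w, hw, O, hO, hflat⟩ := exists_nhds_almost_flat hstrict hd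
  have hzero : ∀ y ∈ frontier A, y ∈ U → ψ y = 0 := fun y hy hyU => by
    have : y ∈ {y | ψ y = 0} ∩ U := hfr ▸ ⟨hy, hyU⟩
    exact this.1
  refine ⟨O ∩ U ∩ Metric.ball x 1, inter_mem (inter_mem hO (hU.mem_nhds hxU))
    (Metric.ball_mem_nhds x one_pos), ?_⟩
  refine exists_volume_thickening_le_of_almost_flat volume (fderiv ℝ ψ x) hw
    (Metric.isBounded_ball.subset fun y hy => hy.2.2) ?_
  rintro y ⟨hy, ⟨hyO, hyU⟩, -⟩ z ⟨hz, ⟨hzO, hzU⟩, -⟩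
  exact hflat y hyO z hzO (hzero y hy hyU) (hzero z hz hzU)

/-- Tubular neighbourhoods of a compact `C²` boundary have at most linear volume. -/
theorem HasC2Boundary.exists_volume_thickening_le {A : Set 𝔼} (hA : HasC2Boundary A)
    (hc : IsCompact (frontier A)) :
    ∃ C : ℝ≥0∞, C ≠ ∞ ∧ ∀ r : ℝ, 0 < r → r ≤ 1 →
      volume (Metric.thickening r (frontier A)) ≤ C * ENNReal.ofReal r := by
  choose! O hO C hC hCr using fun x (hx : x ∈ frontier A) =>
    hA.exists_nhds_volume_thickening_le hx
  obtain ⟨t, ht, hcov⟩ := hc.elim_nhds_subcover O hO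
  refine ⟨∑ x ∈ t, C x, (ENNReal.sum_lt_top.2 fun x hx => (hC x (ht x hx)).lt_top).ne,
    fun r hr hr1 => ?_⟩
  have hsub : Metric.thickening r (frontier A)
      ⊆ ⋃ x ∈ t, Metric.thickening r (frontier A ∩ O x) := by
    intro y hy
    obtain ⟨s, hs, hys⟩ := Metric.mem_thickening_iff.1 hy
    obtain ⟨x, hx, hsx⟩ := Set.mem_iUnion₂.1 (hcov hs)
    exact Set.mem_iUnion₂.2 ⟨x, hx, Metric.mem_thickening_iff.2 ⟨s, ⟨hs, hsx⟩, hys⟩⟩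
  calc volume (Metric.thickening r (frontier A))
      ≤ ∑ x ∈ t, volume (Metric.thickening r (frontier A ∩ O x)) :=
        (measure_mono hsub).trans (measure_biUnion_finset_le _ _)
    _ ≤ ∑ x ∈ t, C x * ENNReal.ofReal r := Finset.sum_le_sum fun x hx => hCr x (ht x hx) r hr hr1
    _ = _ := (Finset.sum_mul _ _ _).symm

/-! ### Slices of a set with compact `C²` boundary -/

/-- If `S` missed the frontier, `interior E` and the complement of `closure E` would disconnect it.
-/
theorem IsPreconnected.inter_frontier_nonempty_of_mem {X : Type*} [TopologicalSpace X]
    {S E : Set X} (hS : IsPreconnected S) {x y : X} (hxS : x ∈ S) (hyS : y ∈ S) (hx : x ∉ E)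
    (hy : y ∈ E) : (S ∩ frontier E).Nonempty := by
  by_contra hne
  have hfr : ∀ z ∈ S, z ∈ closure E → z ∈ interior E := fun z hz hzc => by
    by_contra hzi
    exact hne ⟨z, hz, hzc, hzi⟩
  obtain ⟨z, -, hz1, hz2⟩ := hS (interior E) (closure E)ᶜ isOpen_interior
    isClosed_closure.isOpen_compl
    (fun z hz => (em (z ∈ closure E)).imp (hfr z hz) id)
    ⟨y, hyS, hfr y hyS (subset_closure hy)⟩
    ⟨x, hxS, fun hxc => hx (interior_subset (hfr x hxS hxc))⟩
  exact hz2 (subset_closure (interior_subset hz1))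

/-- A segment joining a point outside `E` to a point of `E` meets the boundary of `E`. -/
theorem mem_thickening_frontier {E : Set 𝔼} {x h : 𝔼} (hx : x ∉ E) (hxh : x + h ∈ E) {r : ℝ}
    (hr : ‖h‖ < r) : x ∈ Metric.thickening r (frontier E) := by
  have hconn : IsPreconnected (segment ℝ x (x + h)) := (convex_segment x (x + h)).isPreconnected
  obtain ⟨y, hy, hyf⟩ := hconn.inter_frontier_nonempty_of_mem
    (left_mem_segment ℝ _ _) (right_mem_segment ℝ _ _) hx hxh
  refine Metric.mem_thickening_iff.2 ⟨y, hyf, lt_of_le_of_lt ?_ hr⟩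
  have := (convex_closedBall x ‖h‖).segment_subset (Metric.mem_closedBall_self (norm_nonneg h))
    (by simp : x + h ∈ Metric.closedBall x ‖h‖) hy
  rwa [dist_comm]

theorem HasC2Boundary.exists_volume_diff_translate_le {A : Set 𝔼} (hA : HasC2Boundary A)
    (hc : IsCompact (frontier A)) :
    ∃ C : ℝ≥0∞, C ≠ ∞ ∧ ∀ h : 𝔼, ‖h‖ ≤ 1 →
      volume {x | x ∉ closure A ∧ x + h ∈ closure A} ≤ C * ENNReal.ofReal ‖h‖ := by
  obtain ⟨C, hC, hCr⟩ := hA.exists_volume_thickening_le hc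
  -- The radius `2 * ‖h‖` leaves room for the strict inequality in the thickening, but must be at
  -- most `1`. Longer `h` are handled by two steps of length `‖h‖ / 2`: along the way, one of them
  -- enters `closure A`.
  have key : ∀ h : 𝔼, 2 * ‖h‖ ≤ 1 →
      volume {x | x ∉ closure A ∧ x + h ∈ closure A} ≤ (2 * C) * ENNReal.ofReal ‖h‖ := by
    intro h hh
    rcases eq_or_ne h 0 with rfl | h0
    · simp
    have hn : 0 < ‖h‖ := norm_pos_iff.2 h0
    refine (measure_mono fun x hx => ?_).trans ((hCr (2 * ‖h‖) (by linarith) hh).trans_eq ?_)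
    · exact Metric.thickening_subset_of_subset _ frontier_closure_subset
        (mem_thickening_frontier hx.1 hx.2 (by linarith))
    · rw [ENNReal.ofReal_mul zero_le_two]
      simp only [ENNReal.ofReal_ofNat]
      ring
  refine ⟨2 * (2 * C), by finiteness, fun h hh => ?_⟩
  set k : 𝔼 := (2⁻¹ : ℝ) • h with hk
  have hkk : h = k + k := by
    rw [hk, ← add_smul]
    norm_num
  have hkn : ‖k‖ = ‖h‖ / 2 := by
    rw [hk, norm_smul]
    norm_num
    ring
  have hsub : {x | x ∉ closure A ∧ x + h ∈ closure A}
      ⊆ {x | x ∉ closure A ∧ x + k ∈ closure A} ∪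
        {x | x + k ∈ {y | y ∉ closure A ∧ y + k ∈ closure A}} := by
    rintro x ⟨hx1, hx2⟩
    by_cases hxk : x + k ∈ closure A
    · exact Or.inl ⟨hx1, hxk⟩
    · exact Or.inr ⟨hxk, by rwa [add_assoc, ← hkk]⟩
  have hb := key k (by linarith)
  calc volume {x | x ∉ closure A ∧ x + h ∈ closure A}
      ≤ (2 * C) * ENNReal.ofReal ‖k‖ + (2 * C) * ENNReal.ofReal ‖k‖ := by
        refine (measure_mono hsub).trans ((measure_union_le _ _).trans (add_le_add hb ?_))
        rwa [volume_preimage_add_right]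
    _ = 2 * (2 * C) * ENNReal.ofReal ‖k‖ := by ring
    _ ≤ _ := by
        gcongr
        linarith [norm_nonneg h]

/-! ### The bound for Caccioppoli sets and the perimeter axioms -/

theorem IsCaccioppoli.nonlocalPerimeter_le {K : 𝔼 → ℝ≥0} (hK : AEMeasurable K volume)
    (hKi : Integrable (fun h => (K h : ℝ) * min 1 ‖h‖) volume) {E Ω : Set 𝔼}
    (hE : IsCaccioppoli E) (hΩ : MeasurableSet Ω) :
    nonlocalPerimeter (fun h => (K h : ℝ≥0∞)) E Ω
      ≤ max (perimeter E / 2) (volume Ω) * ENNReal.ofReal (∫ h, (K h : ℝ) * min 1 ‖h‖) := by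
  obtain ⟨hEm, hEv, -⟩ := hE
  obtain ⟨F, -, hF, hFE⟩ := hEm.exists_measurable_superset_ae_eq
  rw [← nonlocalPerimeter_congr_ae _ Ω hFE, ← perimeter_congr_ae hFE]
  refine nonlocalPerimeter_le_of_slice_le hK hKi hF hΩ _ fun h _ => ?_
  have hb := two_mul_volume_diff_translate_le hF (by rw [measure_congr hFE]; exact hEv.ne) h
  rw [← ENNReal.mul_div_right_comm, ENNReal.le_div_iff_mul_le (by simp) (by simp), mul_comm,
    mul_comm (perimeter F)]
  exact hb

theorem HasC2Boundary.nonlocalPerimeter_closure_lt_top {K : 𝔼 → ℝ≥0} (hK : AEMeasurable K volume)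
    (hKi : Integrable (fun h => (K h : ℝ) * min 1 ‖h‖) volume) {A Ω : Set 𝔼}
    (hA : HasC2Boundary A) (hc : IsCompact (frontier A)) (hΩ : MeasurableSet Ω)
    (hΩ' : volume Ω < ∞) :
    nonlocalPerimeter (fun h => (K h : ℝ≥0∞)) (closure A) Ω < ∞ := by
  obtain ⟨C, hC, hCh⟩ := hA.exists_volume_diff_translate_le hc
  exact (nonlocalPerimeter_le_of_slice_le hK hKi isClosed_closure.measurableSet hΩ C hCh).trans_lt
    (ENNReal.mul_lt_top (max_lt hC.lt_top hΩ') ENNReal.ofReal_lt_top)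

theorem nonlocalPerimeter_isPerimeterIn {K : 𝔼 → ℝ≥0} (hK : AEMeasurable K volume)
    (hKi : Integrable (fun h => (K h : ℝ) * min 1 ‖h‖) volume) {Ω : Set 𝔼} (hΩ : MeasurableSet Ω)
    (hΩ_pos : 0 < volume Ω) (hΩ_fin : volume Ω < ∞) :
    IsPerimeterIn (nonlocalPerimeter (fun h => (K h : ℝ≥0∞))) Ω where
  reference_measurable := hΩ.nullMeasurableSet
  reference_pos := hΩ_pos
  empty := by simp [nonlocalPerimeter, interaction]
  congr_null _ _ _ _ h :=
    nonlocalPerimeter_congr_ae _ Ω (measure_symmDiff_eq_zero_iff.1 h)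
  translation E h _ := nonlocalPerimeter_translate _ E Ω h
  finite_of_C2 _ _ hc hA := hA.nonlocalPerimeter_closure_lt_top hK hKi hc hΩ hΩ_fin
  lowerSemicontinuous _ _ hE hE' hlim :=
    nonlocalPerimeter_lsc hK.coe_nnreal_ennreal hE hE' hΩ hlim
  submodular _ _ hE hF := nonlocalPerimeter_submodular hK.coe_nnreal_ennreal hE hF hΩ

end NonlocalPerimeter

theorem mainTheorem5 (d : ℕ) (hd : 1 ≤ d)
    (K : EuclideanSpace ℝ (Fin d) → ℝ≥0)
    (hK_meas : AEMeasurable K volume)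
    (hK_even : ∀ h, K (-h) = K h)
    (hK_int : Integrable (fun h => (K h : ℝ) * min 1 ‖h‖) volume)
    (Ω : Set (EuclideanSpace ℝ (Fin d)))
    (hΩ_open : IsOpen Ω) (hΩ_pos : 0 < volume Ω) (hΩ_fin : volume Ω < ∞) :
    (∀ E : Set (EuclideanSpace ℝ (Fin d)), IsCaccioppoli E →
      nonlocalPerimeter (fun h => (K h : ℝ≥0∞)) E Ω
          ≤ max (perimeter E / 2) (volume Ω)
            * ENNReal.ofReal (∫ h, (K h : ℝ) * min 1 ‖h‖)
        ∧ nonlocalPerimeter (fun h => (K h : ℝ≥0∞)) E Ω < ∞) ∧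
    IsPerimeterIn (nonlocalPerimeter (fun h => (K h : ℝ≥0∞))) Ω := by
  have hΩ := hΩ_open.measurableSet
  refine ⟨fun E hE => ?_, nonlocalPerimeter_isPerimeterIn hK_meas hK_int hΩ hΩ_pos hΩ_fin⟩
  have hle := hE.nonlocalPerimeter_le hK_meas hK_int hΩ
  refine ⟨hle, hle.trans_lt (ENNReal.mul_lt_top (max_lt ?_ hΩ_fin) ENNReal.ofReal_lt_top)⟩
  exact ENNReal.div_lt_top hE.2.2.ne two_ne_zero
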